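/- Let $N\ge 0$, $p\ge 1$, and let $\Sigma=(\xi^{(1)},\dots,\xi^{(p)})\in\{-1,1\}^{N\times p}$ be a cycle of binary column patterns (upper indices read cyclically modulo $p$), with Moore–Penrose pseudoinverse $\Sigma^+$. Put $\mathbf F=(\xi^{(2)},\dots,\xi^{(p)},\xi^{(1)})$, $\mathbf J=\mathbf F\Sigma^+$, $\mathbf J^0=\Sigma\Sigma^+$, and assume that $\Sigma$ is admissible, i.e. $\mathbf J\Sigma=\mathbf F$. Let $\lambda>0$, $\beta_1\in(0,1)$, $0<C_0<1$, $C_1=1-C_0$, $\beta_K=\operatorname{arctanh}(\beta_1)/(\lambda\beta_1)$ and $\beta=\lambda\beta_K$. Fix $\mu\in\{1,\dots,p\}$ and consider on $\mathbb R^N$ the derived system $\dot{\mathbf u}=\mathbf f(\mathbf u)$, $$f_i(\mathbf u)=-u_i+C_0\beta_K\sum_{j=1}^N J^0_{ij}\tanh(\lambda u_j)+C_1\beta_K\beta_1\xi_i^{(\mu+1)},\qquad i=1,\dots,N.$$ Define $$\hat f_i(x)=-x+C_0\beta_KJ^0_{ii}\tanh(\lambda x)+k_i^+,\qquad \check f_i(x)=-x+C_0\beta_KJ^0_{ii}\tanh(\lambda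 x)+k_i^-,$$ where $k_i^{\pm}=\pm\bigl(C_0\beta_K\sum_{j\ne i}|J^0_{ij}|+C_1\beta_K\beta_1\bigr)$. Suppose that for all $i=1,\dots,N$: (H1) $C_0\beta J^0_{ii}>1$ (so that there are unique $p_i<0<q_i$ such that $\partial_i f_i(\mathbf u)=0$ whenever $u_i=p_i$ or $u_i=q_i$); (H2) $\check f_i(q_i)>0$ and $\hat f_i(p_i)<0$; (H3) $C_0\beta\sum_{j=1}^N|J^0_{ij}|\,(1-\tanh^2(\lambda\eta_j))<1$, where $\eta_j$ satisfies $\tanh^2(\lambda\eta_j)=\min\{\tanh^2(\lambda\check c_j),\tanh^2(\lambda\hat a_j)\}$, $\hat a_j$ being the smallest zero of $\hat f_j$ and $\check c_j$ the largest zero of $\check f_j$. Then the derived system has exactly $2^N$ asymptotically stable equilibria, i.e. exactly $2^N$ points $\mathbf u^*$ with $\mathbf f(\mathbf u^*)=\mathbf 0$ that are Lyapunov stable and locally attractive. -/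

import Mathlib

open Matrix

noncomputable section

/-! ### Moore-Penrose pseudoinverse of a real matrix -/

/-- The four Penrose equations: `X` is a Moore-Penrose pseudoinverse of the real matrix `A`. -/
structure IsMoorePenroseInverse {m n : Type*} [Fintype m] [Fintype n]
    (A : Matrix m n ℝ) (X : Matrix n m ℝ) : Prop where
  mul_mul_left : A * X * A = A
  mul_mul_right : X * A * X = X
  symm_left : (A * X)ᵀ = A * X
  symm_right : (X * A)ᵀ = X * A

theorem exists_isMoorePenroseInverse {m n : Type*} [Fintype m] [Fintype n]
    (A : Matrix m n ℝ) : ∃ X : Matrix n m ℝ, IsMoorePenroseInverse A X := by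
  classical
  obtain ⟨G, hG1, hG2, hG3, hG4⟩ : ∃ G : Matrix n n ℝ, (Aᵀ * A) * G * (Aᵀ * A) = Aᵀ * A ∧
      G * (Aᵀ * A) * G = G ∧ Gᵀ = G ∧ (G * (Aᵀ * A))ᵀ = G * (Aᵀ * A) := by
    have hH : (Aᵀ * A).IsHermitian := by
      simpa using isHermitian_conjTranspose_mul_self A
    obtain ⟨U, hU, d, hd⟩ : ∃ U : Matrix n n ℝ, Uᵀ * U = 1 ∧ ∃ d : n → ℝ,
        Aᵀ * A = U * diagonal d * Uᵀ := by
      refine ⟨hH.eigenvectorUnitary, ?_, hH.eigenvalues, ?_⟩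
      · simpa [star_eq_conjTranspose] using
          (Unitary.mem_iff.mp hH.eigenvectorUnitary.2).1
      · have := hH.spectral_theorem
        simpa [Unitary.conjStarAlgAut_apply, star_eq_conjTranspose, Function.comp_def] using this
    have key : ∀ a b : n → ℝ, (U * diagonal a * Uᵀ) * (U * diagonal b * Uᵀ)
        = U * diagonal (fun i => a i * b i) * Uᵀ := by
      intro a b
      calc (U * diagonal a * Uᵀ) * (U * diagonal b * Uᵀ)
          = U * diagonal a * (Uᵀ * U) * diagonal b * Uᵀ := by simp only [Matrix.mul_assoc]
        _ = _ := by rw [hU, Matrix.mul_one, Matrix.mul_assoc U, diagonal_mul_diagonal]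
    have hsym : ∀ a : n → ℝ, (U * diagonal a * Uᵀ)ᵀ = U * diagonal a * Uᵀ := by
      intro a
      simp [Matrix.transpose_mul, Matrix.mul_assoc]
    refine ⟨U * diagonal (fun i => (d i)⁻¹) * Uᵀ, ?_, ?_, hsym _, ?_⟩
    · rw [hd, key, key]
      congr 3
      funext i
      exact mul_inv_mul_cancel (d i)
    · rw [hd, key, key]
      congr 3
      funext i
      by_cases h : d i = 0 <;> simp [h]
    · rw [hd, key, hsym]
  have hAG : A * (G * (Aᵀ * A)) = A := by
    have h0 : Aᴴ * A * (G * (Aᵀ * A) - 1) = 0 := by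
      rw [conjTranspose_eq_transpose_of_trivial, Matrix.mul_sub, ← Matrix.mul_assoc, hG1,
        Matrix.mul_one, sub_self]
    have h1 := (conjTranspose_mul_self_mul_eq_zero A _).mp h0
    rw [Matrix.mul_sub, Matrix.mul_one] at h1
    exact sub_eq_zero.mp h1
  refine ⟨G * Aᵀ, ?_, ?_, ?_, ?_⟩
  · simpa only [Matrix.mul_assoc] using hAG
  · calc G * Aᵀ * A * (G * Aᵀ) = (G * (Aᵀ * A) * G) * Aᵀ := by simp only [Matrix.mul_assoc]
      _ = _ := by rw [hG2]
  · simp [Matrix.transpose_mul, hG3, Matrix.mul_assoc]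
  · simpa only [Matrix.mul_assoc] using hG4

theorem IsMoorePenroseInverse.unique {m n : Type*} [Fintype m] [Fintype n]
    {A : Matrix m n ℝ} {X Y : Matrix n m ℝ} (hX : IsMoorePenroseInverse A X)
    (hY : IsMoorePenroseInverse A Y) : X = Y := by
  have h1 : A * X = A * Y := by
    calc A * X = (A * X)ᵀ := hX.symm_left.symm
      _ = ((A * Y) * (A * X))ᵀ := by rw [← Matrix.mul_assoc, hY.mul_mul_left]
      _ = (A * X) * (A * Y) := by rw [Matrix.transpose_mul, hX.symm_left, hY.symm_left]
      _ = A * Y := by rw [← Matrix.mul_assoc, hX.mul_mul_left]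
  have h2 : X * A = Y * A := by
    calc X * A = (X * A)ᵀ := hX.symm_right.symm
      _ = ((X * A) * (Y * A))ᵀ := by
        rw [Matrix.mul_assoc X, ← Matrix.mul_assoc A, hY.mul_mul_left]
      _ = (Y * A) * (X * A) := by rw [Matrix.transpose_mul, hX.symm_right, hY.symm_right]
      _ = Y * A := by rw [Matrix.mul_assoc Y, ← Matrix.mul_assoc A, hX.mul_mul_left]
  calc X = X * A * X := hX.mul_mul_right.symm
    _ = Y * A * Y := by rw [Matrix.mul_assoc, h1, ← Matrix.mul_assoc, h2]
    _ = Y := hY.mul_mul_right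

/-- The Moore-Penrose pseudoinverse `A⁺` of a real matrix. -/
def pseudoinverse {m n : Type*} [Fintype m] [Fintype n] (A : Matrix m n ℝ) : Matrix n m ℝ :=
  Classical.choose (exists_isMoorePenroseInverse A)

theorem pseudoinverse_spec {m n : Type*} [Fintype m] [Fintype n] (A : Matrix m n ℝ) :
    IsMoorePenroseInverse A (pseudoinverse A) :=
  Classical.choose_spec (exists_isMoorePenroseInverse A)

/-! ### Cycles of binary patterns and pseudoinverse learning rule -/

/-- All entries are `1` or `-1`; column `μ` of `S` is the pattern `ξ^(μ)`. -/
def IsBinaryCycle {N p : ℕ} (S : Matrix (Fin N) (Fin p) ℝ) : Prop :=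
  ∀ i μ, S i μ = 1 ∨ S i μ = -1

/-- The cycle shifted leftwards by one pattern (column indices are read cyclically). -/
def shiftCycle {N p : ℕ} [NeZero p] (S : Matrix (Fin N) (Fin p) ℝ) : Matrix (Fin N) (Fin p) ℝ :=
  Matrix.of fun i μ => S i (μ + 1)

/-- Projection learning rule `J⁰ = Σ Σ⁺`. -/
def projectionMatrix {N p : ℕ} (S : Matrix (Fin N) (Fin p) ℝ) : Matrix (Fin N) (Fin N) ℝ :=
  S * pseudoinverse S

/-- Associating learning rule `J = F Σ⁺`. -/
def transitionMatrix {N p : ℕ} [NeZero p] (S : Matrix (Fin N) (Fin p) ℝ) :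
    Matrix (Fin N) (Fin N) ℝ :=
  shiftCycle S * pseudoinverse S

/-- The cycle is admissible: `J Σ = F`. -/
def IsAdmissible {N p : ℕ} [NeZero p] (S : Matrix (Fin N) (Fin p) ℝ) : Prop :=
  transitionMatrix S * S = shiftCycle S

/-- A Hopfield-type network on `N` neurons constructed from an admissible cycle of `p` binary
patterns, with gain `gain` (`λ`), parameter `β₁`, and relative contribution `C₀` of `J⁰`. -/
structure CyclicNetwork (N p : ℕ) [NeZero p] where
  cycle : Matrix (Fin N) (Fin p) ℝ
  binary : IsBinaryCycle cycle
  admissible : IsAdmissible cycle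
  gain : ℝ
  gain_pos : 0 < gain
  β₁ : ℝ
  β₁_pos : 0 < β₁
  β₁_lt_one : β₁ < 1
  C₀ : ℝ
  C₀_pos : 0 < C₀
  C₀_lt_one : C₀ < 1

namespace CyclicNetwork

variable {N p : ℕ} [NeZero p] (W : CyclicNetwork N p)

/-- `J⁰`. -/
def J₀ : Matrix (Fin N) (Fin N) ℝ := projectionMatrix W.cycle

/-- `C₁ = 1 - C₀`. -/
def C₁ : ℝ := 1 - W.C₀

/-- `β_K = arctanh β₁ / (λ β₁)`. -/
def βK : ℝ := Real.artanh W.β₁ / (W.gain * W.β₁)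

/-- `β = β_K λ`. -/
def β : ℝ := W.βK * W.gain

/-- Right-hand side of the derived system
`u' = -u + C₀ β_K J⁰ tanh(λ u) + C₁ β_K β₁ ξ^(μ+1)`. -/
def field (μ : Fin p) (u : Fin N → ℝ) : Fin N → ℝ := fun i =>
  -u i + W.C₀ * W.βK * ∑ j, W.J₀ i j * Real.tanh (W.gain * u j)
    + W.C₁ * W.βK * W.β₁ * W.cycle i (μ + 1)

/-- `∂ᵢ fᵢ` vanishes wherever `uᵢ = x`. -/
def IsTurningPoint (μ : Fin p) (i : Fin N) (x : ℝ) : Prop :=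
  ∀ u : Fin N → ℝ, u i = x →
    HasDerivAt (fun y => W.field μ (Function.update u i y) i) 0 x

/-- `kᵢ⁺ = C₀ β_K ∑_{j ≠ i} |J⁰ᵢⱼ| + C₁ β_K β₁`. -/
def kPlus (i : Fin N) : ℝ :=
  W.C₀ * W.βK * ∑ j ∈ Finset.univ.erase i, |W.J₀ i j| + W.C₁ * W.βK * W.β₁

/-- `kᵢ⁻ = -C₀ β_K ∑_{j ≠ i} |J⁰ᵢⱼ| - C₁ β_K β₁`. -/
def kMinus (i : Fin N) : ℝ :=
  -(W.C₀ * W.βK * ∑ j ∈ Finset.univ.erase i, |W.J₀ i j|) - W.C₁ * W.βK * W.β₁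

/-- The upper bounding function `f̂ᵢ`. -/
def upper (i : Fin N) (x : ℝ) : ℝ :=
  -x + W.C₀ * W.βK * W.J₀ i i * Real.tanh (W.gain * x) + W.kPlus i

/-- The lower bounding function `f̌ᵢ`. -/
def lower (i : Fin N) (x : ℝ) : ℝ :=
  -x + W.C₀ * W.βK * W.J₀ i i * Real.tanh (W.gain * x) + W.kMinus i

end CyclicNetwork

/-! ### Asymptotic stability -/

/-- `x₀` is an asymptotically stable equilibrium of the autonomous equation `γ' = F(γ)`: it is an
equilibrium, Lyapunov stable (for solutions on `[0, T]`, every `T`), and locally attractive (for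
solutions on `[0, ∞)`). -/
structure IsAsymptoticallyStableEquilibrium {E : Type*} [NormedAddCommGroup E] [NormedSpace ℝ E]
    (F : E → E) (x₀ : E) : Prop where
  equilibrium : F x₀ = 0
  stable : ∀ ε > 0, ∃ δ > 0, ∀ (T : ℝ) (γ : ℝ → E),
    IsIntegralCurveOn γ (fun _ => F) (Set.Icc 0 T) → ‖γ 0 - x₀‖ < δ →
      ∀ t ∈ Set.Icc 0 T, ‖γ t - x₀‖ < ε
  attractive : ∃ δ > 0, ∀ γ : ℝ → E,
    IsIntegralCurveOn γ (fun _ => F) (Set.Ici 0) → ‖γ 0 - x₀‖ < δ →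
      Filter.Tendsto γ Filter.atTop (nhds x₀)

end

/-! Write the system as `u' = G(u) - u` with `G(u) = f(u) + u`, let `c i` be the largest zero of the
lower bounding function, and attach to each sign vector `s` the box of states with `s i * u i ≥ c
i`. Since `tanh` is odd and bounded by 1, `s i * f i(u)` is at least the lower function at `s i * u
i`; adding the identity makes that function increasing, so `G` maps every box into itself
(`mapsTo_signBox`). On a box the slopes of `tanh` are at most those at `c`, and (H3) bounds the row
sums of `|G'|` by a constant below 1: `G` is a contraction in the sup norm
(`norm_field_add_sub_le`). Banach's theorem yields one equilibrium per box, and the `2 ^ N` boxes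
are disjoint because `c i > 0`.

These equilibria are stable because the contraction towards each of them persists on a full
neighbourhood, and then `exp t * ‖γ t - x₀‖` grows more slowly than `exp t`
(`norm_sub_le_exp_of_contracting`).

There are no others. As `J⁰` is symmetric, the field is minus the gradient of an energy up to
positive factors (`hasDerivAt_energy_comp`). Solutions are global and the energy decreases along
them, so an asymptotically stable equilibrium is a local minimum of it. A positive diagonal slope
`∂ᵢ fᵢ` would allow a descent along the `i`-th axis; hence every `|u i|` is at least the turning
point `q i`. Beyond `q i` the lower function decreases strictly and is nonpositive at `|u i|`, which
forces `|u i| ≥ c i`: the equilibrium lies in a box. -/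

noncomputable section

/-! ### Hyperbolic tangent -/

theorem Real.hasDerivAt_tanh_sub_sq (x : ℝ) : HasDerivAt Real.tanh (1 - Real.tanh x ^ 2) x := by
  have h : Real.tanh = fun y => Real.sinh y / Real.cosh y :=
    funext Real.tanh_eq_sinh_div_cosh
  have hc := (Real.cosh_pos x).ne'
  rw [h]
  refine ((Real.hasDerivAt_sinh x).div (Real.hasDerivAt_cosh x) hc).congr_deriv (Eq.symm ?_)
  rw [eq_div_iff (pow_ne_zero 2 hc), sub_mul, div_pow, div_mul_cancel₀ _ (pow_ne_zero 2 hc)]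
  ring

theorem Real.hasDerivAt_tanh_const_mul (l x : ℝ) :
    HasDerivAt (fun y => Real.tanh (l * y)) (l * (1 - Real.tanh (l * x) ^ 2)) x := by
  have := (Real.hasDerivAt_tanh_sub_sq (l * x)).comp x ((hasDerivAt_id x).const_mul l)
  simpa [Function.comp_def, mul_comm] using this

theorem Real.one_sub_tanh_sq_pos (x : ℝ) : 0 < 1 - Real.tanh x ^ 2 :=
  sub_pos.2 (Real.tanh_sq_lt_one x)

theorem Real.strictMono_tanh_of_deriv : StrictMono Real.tanh :=
  strictMono_of_deriv_pos fun x => by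
    rw [(Real.hasDerivAt_tanh_sub_sq x).deriv]
    exact Real.one_sub_tanh_sq_pos x

theorem Real.abs_tanh_eq_tanh_abs (x : ℝ) : |Real.tanh x| = Real.tanh |x| := by
  rcases le_total 0 x with h | h
  · rw [abs_of_nonneg h, abs_of_nonneg]
    simpa using Real.strictMono_tanh_of_deriv.monotone h
  · rw [abs_of_nonpos h, abs_of_nonpos, Real.tanh_neg]
    simpa using Real.strictMono_tanh_of_deriv.monotone h

theorem Real.tanh_sq_le_tanh_sq {x y : ℝ} (h : |x| ≤ |y|) :
    Real.tanh x ^ 2 ≤ Real.tanh y ^ 2 := by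
  rw [sq_le_sq, Real.abs_tanh_eq_tanh_abs, Real.abs_tanh_eq_tanh_abs]
  exact Real.strictMono_tanh_of_deriv.monotone h

theorem Real.tanh_sq_lt_tanh_sq {x y : ℝ} (h : |x| < |y|) :
    Real.tanh x ^ 2 < Real.tanh y ^ 2 := by
  rw [sq_lt_sq, Real.abs_tanh_eq_tanh_abs, Real.abs_tanh_eq_tanh_abs]
  exact Real.strictMono_tanh_of_deriv h

theorem Real.contDiff_tanh {n : WithTop ℕ∞} : ContDiff ℝ n Real.tanh := by
  have h : Real.tanh = fun y => Real.sinh y / Real.cosh y :=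
    funext Real.tanh_eq_sinh_div_cosh
  rw [h]
  exact Real.contDiff_sinh.div Real.contDiff_cosh fun x => (Real.cosh_pos x).ne'

/-- On a convex set where `tanh² (l x) ≥ m`, the function `tanh (l x)` has Lipschitz constant
`l (1 - m)`. -/
theorem Real.abs_tanh_sub_le_of_convex {l m : ℝ} (hl : 0 ≤ l) {s : Set ℝ} (hs : Convex ℝ s)
    (hm : ∀ x ∈ s, m ≤ Real.tanh (l * x) ^ 2) {x y : ℝ} (hx : x ∈ s) (hy : y ∈ s) :
    |Real.tanh (l * x) - Real.tanh (l * y)| ≤ l * (1 - m) * |x - y| := by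
  refine hs.norm_image_sub_le_of_norm_hasDerivWithin_le (f := fun y => Real.tanh (l * y))
    (fun z _ => (Real.hasDerivAt_tanh_const_mul l z).hasDerivWithinAt) (fun z hz => ?_) hy hx
  rw [Real.norm_of_nonneg (mul_nonneg hl (Real.one_sub_tanh_sq_pos _).le)]
  gcongr
  exact hm z hz

/-! ### Global solutions and asymptotic stability -/

section ODE

variable {E : Type*} [NormedAddCommGroup E] [NormedSpace ℝ E]

/-- A continuously differentiable, globally Lipschitz vector field is complete. -/
theorem exists_isIntegralCurve_of_lipschitzWith [CompleteSpace E] {F : E → E} {K : NNReal}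
    (hF : ContDiff ℝ 1 F) (hK : LipschitzWith K F) (x : E) :
    ∃ γ : ℝ → E, γ 0 = x ∧ IsIntegralCurve γ (fun _ => F) := by
  have hpos : (0 : ℝ) < 1 + K := by positivity
  -- On the ball of radius `‖F y‖ + 1` about `y` the field is bounded by `(‖F y‖ + 1) * (1 + K)`.
  -- The ratio of radius to bound is an existence time independent of `y`, and a uniform existence
  -- time gives global solutions.
  have hε : 0 < 1 / (1 + K : ℝ) := by positivity
  obtain ⟨γ, h0, hγ⟩ := exists_isMIntegralCurve_of_isMIntegralCurveOn
    (I := modelWithCornersSelf ℝ E) (M := E) (v := F)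
    (contMDiff_vectorSpace_iff_contDiff.2 hF) hε (fun y => by
      have h0 : (0 : ℝ) ∈ Set.Icc (-(1 / (1 + K : ℝ))) (1 / (1 + K : ℝ)) :=
        ⟨by linarith, hε.le⟩
      have hP : IsPicardLindelof (fun _ => F) ⟨0, h0⟩ y (‖F y‖₊ + 1) 0
          ((‖F y‖₊ + 1) * (1 + K)) K := by
        refine IsPicardLindelof.of_time_independent (fun z hz => ?_) hK.lipschitzOnWith ?_
        · have h1 : ‖F z - F y‖ ≤ K * ‖z - y‖ := by simpa [dist_eq_norm] using hK.dist_le_mul z y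
          have h2 : ‖z - y‖ ≤ ‖F y‖ + 1 := by simpa [dist_eq_norm] using hz
          have h3 : ‖F z‖ ≤ ‖F z - F y‖ + ‖F y‖ := by
            simpa using norm_add_le (F z - F y) (F y)
          have h4 : K * ‖z - y‖ ≤ K * (‖F y‖ + 1) := by gcongr
          push_cast
          linarith
        · have h1 : max (1 / (1 + K : ℝ) - 0) (0 - -(1 / (1 + K : ℝ))) = 1 / (1 + K : ℝ) := by
            simp
          push_cast
          rw [h1, mul_assoc, mul_one_div_cancel hpos.ne']
          simp
      obtain ⟨α, hα0, hα⟩ := hP.exists_eq_forall_mem_Icc_hasDerivWithinAt₀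
      refine ⟨α, hα0, fun t ht => ?_⟩
      have : HasDerivWithinAt α (F (α t)) (Set.Ioo (-(1 / (1 + K : ℝ))) (1 / (1 + K : ℝ))) t :=
        (hα t (Set.Ioo_subset_Icc_self ht)).mono Set.Ioo_subset_Icc_self
      exact hasMFDerivWithinAt_iff_hasFDerivWithinAt.2 this.hasFDerivWithinAt) x
  refine ⟨γ, h0, fun t => ?_⟩
  have h : HasFDerivAt γ (ContinuousLinearMap.toSpanSingleton ℝ (F (γ t))) t :=
    hasMFDerivAt_iff_hasFDerivAt.1 (hγ t)
  simpa using h.hasDerivAt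

/-- The factor `exp s` absorbs the term `-x` of the field: `exp s • (γ s - x₀)` has derivative `exp
s • (F (γ s) + (γ s - x₀))`, which is at most `κ` times its own norm while the solution stays in the
ball. The gap between `κ` and `κ'` supplies the strict inequality that the comparison with `ρ * exp
(κ' * s)` needs. -/
theorem norm_sub_le_exp_of_contracting {F : E → E} {x₀ : E} {κ κ' r ρ : ℝ} (hκ : κ < κ')
    (hκ' : κ' < 1) (hF : ∀ x, ‖x - x₀‖ ≤ r → ‖F x + (x - x₀)‖ ≤ κ * ‖x - x₀‖)
    (hρ : 0 < ρ) (hρr : ρ ≤ r) {T : ℝ} {γ : ℝ → E}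
    (hγ : IsIntegralCurveOn γ (fun _ => F) (Set.Icc 0 T)) (h0 : ‖γ 0 - x₀‖ ≤ ρ) {t : ℝ}
    (ht : t ∈ Set.Icc 0 T) : ‖γ t - x₀‖ ≤ ρ * Real.exp ((κ' - 1) * t) := by
  have hnorm : ∀ s, ‖Real.exp s • (γ s - x₀)‖ = Real.exp s * ‖γ s - x₀‖ := fun s => by
    rw [norm_smul, Real.norm_of_nonneg (Real.exp_pos s).le]
  have key : ‖Real.exp t • (γ t - x₀)‖ ≤ ρ * Real.exp (κ' * t) := by
    refine image_norm_le_of_norm_deriv_right_lt_deriv_boundary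
      (f := fun s => Real.exp s • (γ s - x₀))
      (f' := fun s => Real.exp s • (F (γ s) + (γ s - x₀)))
      (B := fun s => ρ * Real.exp (κ' * s)) (B' := fun s => κ' * (ρ * Real.exp (κ' * s)))
      (a := 0) (b := T) ?_ ?_ ?_ ?_ ?_ ht
    · exact Real.continuous_exp.continuousOn.smul (hγ.continuousOn.sub continuousOn_const)
    · intro s hs
      have h1 : HasDerivWithinAt γ (F (γ s)) (Set.Ici s) s := by
        refine (hγ s ⟨hs.1, hs.2.le⟩).mono_of_mem_nhdsWithin ?_
        exact Filter.mem_of_superset (Icc_mem_nhdsGE hs.2) (Set.Icc_subset_Icc_left hs.1)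
      have h2 := (Real.hasDerivAt_exp s).hasDerivWithinAt.smul (h1.sub_const x₀)
      rw [smul_add]
      exact h2
    · simpa using h0
    · intro s
      refine (((hasDerivAt_id s).const_mul κ').exp.const_mul ρ).congr_deriv ?_
      simp only [id_eq]
      ring
    · intro s hs hsB
      rw [hnorm] at hsB
      have hpos : 0 < ρ * Real.exp (κ' * s) := by positivity
      -- Strictness is needed only where the bound is attained; there `κ' < 1` already places the
      -- solution in the ball, so no separate invariance argument is required.
      have hle : ‖γ s - x₀‖ ≤ ρ := by
        have : Real.exp s * ‖γ s - x₀‖ ≤ Real.exp s * ρ := by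
          rw [hsB, mul_comm]
          gcongr
          nlinarith [hs.1]
        exact le_of_mul_le_mul_left this (Real.exp_pos s)
      rw [norm_smul, Real.norm_of_nonneg (Real.exp_pos s).le]
      calc Real.exp s * ‖F (γ s) + (γ s - x₀)‖
          ≤ Real.exp s * (κ * ‖γ s - x₀‖) := by
            gcongr
            exact hF _ (hle.trans hρr)
        _ = κ * (ρ * Real.exp (κ' * s)) := by rw [← hsB]; ring
        _ < κ' * (ρ * Real.exp (κ' * s)) := by gcongr
  rw [hnorm] at key
  refine le_of_mul_le_mul_left (key.trans_eq ?_) (Real.exp_pos t)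
  rw [mul_left_comm, ← Real.exp_add]
  ring_nf

/-- If `x ↦ F x + x` contracts towards the zero `x₀` of `F`, then `x₀` is asymptotically stable. -/
theorem isAsymptoticallyStableEquilibrium_of_contracting {F : E → E} {x₀ : E} {κ r : ℝ}
    (h0 : F x₀ = 0) (hκ : κ < 1) (hr : 0 < r)
    (hF : ∀ x, ‖x - x₀‖ ≤ r → ‖F x + (x - x₀)‖ ≤ κ * ‖x - x₀‖) :
    IsAsymptoticallyStableEquilibrium F x₀ := by
  obtain ⟨κ', h1, h2⟩ := exists_between hκ
  refine ⟨h0, fun ε hε => ?_, r, hr, fun γ hγ hγ0 => ?_⟩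
  · refine ⟨min r (ε / 2), by positivity, fun T γ hγ hγ0 t ht => ?_⟩
    have := norm_sub_le_exp_of_contracting h1 h2 hF (ρ := min r (ε / 2)) (by positivity)
      (min_le_left _ _) hγ hγ0.le ht
    refine this.trans_lt ?_
    have hexp : Real.exp ((κ' - 1) * t) ≤ 1 := by
      rw [Real.exp_le_one_iff]
      nlinarith [ht.1]
    calc min r (ε / 2) * Real.exp ((κ' - 1) * t) ≤ (ε / 2) * 1 := by
          gcongr
          exact min_le_right _ _
      _ < ε := by linarith
  · rw [tendsto_iff_norm_sub_tendsto_zero]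
    have hlim : Filter.Tendsto (fun t : ℝ => r * Real.exp ((κ' - 1) * t)) Filter.atTop
        (nhds 0) := by
      have h3 : Filter.Tendsto (fun t : ℝ => (κ' - 1) * t) Filter.atTop Filter.atBot :=
        Filter.tendsto_id.const_mul_atTop_of_neg (by linarith)
      simpa using (Real.tendsto_exp_atBot.comp h3).const_mul r
    refine squeeze_zero' (Filter.Eventually.of_forall fun t => norm_nonneg _) ?_ hlim
    filter_upwards [Filter.eventually_ge_atTop (0 : ℝ)] with t ht
    exact norm_sub_le_exp_of_contracting h1 h2 hF hr le_rfl
      (hγ.mono Set.Icc_subset_Ici_self) hγ0.le ⟨ht, le_rfl⟩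

/-- A function that decreases along the solutions of a complete vector field has a local minimum
at every asymptotically stable equilibrium where it is continuous. -/
theorem IsAsymptoticallyStableEquilibrium.isLocalMin {F : E → E} {x₀ : E}
    (h : IsAsymptoticallyStableEquilibrium F x₀)
    (hex : ∀ x, ∃ γ : ℝ → E, γ 0 = x ∧ IsIntegralCurve γ (fun _ => F)) {V : E → ℝ}
    (hV : ContinuousAt V x₀)
    (hanti : ∀ γ : ℝ → E, IsIntegralCurve γ (fun _ => F) → Antitone (V ∘ γ)) :
    IsLocalMin V x₀ := by
  obtain ⟨δ, hδ, hattr⟩ := h.attractive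
  filter_upwards [Metric.ball_mem_nhds x₀ hδ] with x hx
  obtain ⟨γ, h0, hγ⟩ := hex x
  have hlim := hattr γ (hγ.isIntegralCurveOn _) (by rwa [h0, ← dist_eq_norm])
  have := (hanti γ hγ).le_of_tendsto (hV.tendsto.comp hlim) 0
  simpa [h0] using this

end ODE

/-- The index type may be empty and the values negative, while `κ` has to serve as a Lipschitz
constant; hence `0 ≤ κ` is included, and `κ` is taken just below 1 instead of as a maximum. -/
theorem exists_lt_one_forall_le {ι : Type*} [Finite ι] {f : ι → ℝ} (hf : ∀ i, f i < 1) :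
    ∃ κ, 0 ≤ κ ∧ κ < 1 ∧ ∀ i, f i ≤ κ := by
  have h : ∀ᶠ κ in nhdsWithin (1 : ℝ) (Set.Iio 1), (0 ≤ κ ∧ κ < 1) ∧ ∀ i, f i ≤ κ := by
    refine Filter.Eventually.and (Filter.Eventually.and ?_ self_mem_nhdsWithin)
      (Filter.eventually_all.2 fun i => ?_)
    · exact nhdsWithin_le_nhds (eventually_ge_nhds one_pos)
    · exact nhdsWithin_le_nhds (eventually_ge_nhds (hf i))
  obtain ⟨κ, ⟨h0, h1⟩, h2⟩ := h.exists
  exact ⟨κ, h0, h1, h2⟩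

namespace CyclicNetwork

variable {N p : ℕ} [NeZero p] (W : CyclicNetwork N p)

theorem βK_pos : 0 < W.βK :=
  div_pos (Real.artanh_pos ⟨W.β₁_pos, W.β₁_lt_one⟩) (mul_pos W.gain_pos W.β₁_pos)

theorem β_pos : 0 < W.β := mul_pos W.βK_pos W.gain_pos

theorem C₁_pos : 0 < W.C₁ := sub_pos.2 W.C₀_lt_one

/-- One of the Penrose equations. This symmetry is what makes the field a gradient up to positive
factors. -/
theorem J₀_symm (i j : Fin N) : W.J₀ i j = W.J₀ j i :=
  congrFun₂ (pseudoinverse_spec W.cycle).symm_left j i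

theorem abs_cycle (i : Fin N) (ν : Fin p) : |W.cycle i ν| = 1 := by
  rcases W.binary i ν with h | h <;> simp [h]

/-! ### Energy -/

/-- The Lyapunov function of the derived system. -/
def energy (μ : Fin p) (u : Fin N → ℝ) : ℝ :=
  ∑ i, (u i * Real.tanh (W.gain * u i) - Real.log (Real.cosh (W.gain * u i)) / W.gain)
    - W.C₀ * W.βK / 2 *
      ∑ i, ∑ j, W.J₀ i j * (Real.tanh (W.gain * u i) * Real.tanh (W.gain * u j))
    - ∑ i, W.C₁ * W.βK * W.β₁ * W.cycle i (μ + 1) * Real.tanh (W.gain * u i)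

/-- The first summand is built so that its derivative is `u i` times that of `tanh (λ u i)`; every
term then carries the factor `λ (1 - tanh²)`, and the cofactors add up to `-f i`. The velocity `v`
is left free: it is the field itself along solutions, and a unit vector along a coordinate axis. -/
theorem hasDerivAt_energy_comp (μ : Fin p) {γ : ℝ → Fin N → ℝ} {v : Fin N → ℝ} {t : ℝ}
    (hγ : HasDerivAt γ v t) :
    HasDerivAt (fun s => W.energy μ (γ s))
      (-∑ i, W.gain * (1 - Real.tanh (W.gain * γ t i) ^ 2) * v i * W.field μ (γ t) i) t := by
  have hg := W.gain_pos.ne'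
  set d : Fin N → ℝ := fun i => W.gain * (1 - Real.tanh (W.gain * γ t i) ^ 2) * v i with hd
  have hγi : ∀ i, HasDerivAt (fun s => γ s i) (v i) t := hasDerivAt_pi.1 hγ
  have hT : ∀ i, HasDerivAt (fun s => Real.tanh (W.gain * γ s i)) (d i) t := fun i =>
    HasDerivAt.comp (h₂ := fun y => Real.tanh (W.gain * y)) t
      (Real.hasDerivAt_tanh_const_mul W.gain (γ t i)) (hγi i)
  have hL : ∀ i, HasDerivAt (fun s => γ s i * Real.tanh (W.gain * γ s i)
      - Real.log (Real.cosh (W.gain * γ s i)) / W.gain) (γ t i * d i) t := fun i => by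
    have h1 := (((hγi i).const_mul W.gain).cosh.log
      (Real.cosh_pos (W.gain * γ t i)).ne').div_const W.gain
    refine (((hγi i).mul (hT i)).sub h1).congr_deriv ?_
    rw [Real.tanh_eq_sinh_div_cosh (W.gain * γ t i)]
    have := (Real.cosh_pos (W.gain * γ t i)).ne'
    field_simp
    ring
  have hQ := (HasDerivAt.fun_sum (u := Finset.univ) fun i _ =>
    HasDerivAt.fun_sum (u := Finset.univ) fun j _ =>
      ((hT i).mul (hT j)).const_mul (W.J₀ i j)).const_mul (W.C₀ * W.βK / 2)
  have hC := HasDerivAt.fun_sum (u := Finset.univ) fun i _ =>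
    (hT i).const_mul (W.C₁ * W.βK * W.β₁ * W.cycle i (μ + 1))
  refine (((HasDerivAt.fun_sum (u := Finset.univ) fun i _ => hL i).sub hQ).sub hC).congr_deriv ?_
  -- The two halves of the product rule agree by symmetry of `J⁰`; the resulting 2 cancels the `/ 2`
  -- in the energy.
  have hsym : ∑ i, ∑ j, W.J₀ i j * (d i * Real.tanh (W.gain * γ t j)
        + Real.tanh (W.gain * γ t i) * d j)
      = 2 * ∑ i, d i * ∑ j, W.J₀ i j * Real.tanh (W.gain * γ t j) := by
    have h2 : ∑ i, ∑ j, W.J₀ i j * (Real.tanh (W.gain * γ t i) * d j)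
        = ∑ i, ∑ j, W.J₀ i j * (d i * Real.tanh (W.gain * γ t j)) := by
      rw [Finset.sum_comm]
      refine Finset.sum_congr rfl fun i _ => Finset.sum_congr rfl fun j _ => ?_
      rw [W.J₀_symm j i]
      ring
    simp only [mul_add, Finset.sum_add_distrib, h2, Finset.mul_sum, ← two_mul]
    refine Finset.sum_congr rfl fun i _ => Finset.sum_congr rfl fun j _ => ?_
    ring
  rw [hsym, ← mul_assoc, div_mul_cancel₀ _ (two_ne_zero), Finset.mul_sum,
    ← Finset.sum_sub_distrib, ← Finset.sum_sub_distrib, ← Finset.sum_neg_distrib]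
  refine Finset.sum_congr rfl fun i _ => ?_
  simp only [field]
  ring

theorem energy_antitone (μ : Fin p) {γ : ℝ → Fin N → ℝ}
    (hγ : IsIntegralCurve γ (fun _ => W.field μ)) : Antitone (W.energy μ ∘ γ) := by
  refine antitone_of_hasDerivAt_nonpos (fun t => W.hasDerivAt_energy_comp μ (hγ t)) fun t => ?_
  refine neg_nonpos.2 (Finset.sum_nonneg fun i _ => ?_)
  rw [mul_assoc]
  exact mul_nonneg (mul_nonneg W.gain_pos.le (Real.one_sub_tanh_sq_pos _).le)
    (mul_self_nonneg _)

theorem continuous_energy (μ : Fin p) : Continuous (W.energy μ) := by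
  have hT : ∀ i, Continuous fun u : Fin N → ℝ => Real.tanh (W.gain * u i) := fun i =>
    (Real.contDiff_tanh (n := 0)).continuous.comp (by fun_prop)
  have hL : ∀ i, Continuous fun u : Fin N → ℝ => Real.log (Real.cosh (W.gain * u i)) := fun i =>
    (by fun_prop : Continuous fun u : Fin N → ℝ => Real.cosh (W.gain * u i)).log
      fun u => (Real.cosh_pos _).ne'
  unfold energy
  fun_prop

/-! ### Contraction estimates and global solutions -/

/-- The mean value inequality in each coordinate, followed by the row-sum bound that belongs to the
sup norm. The convex sets and the bounds `m` are left free for three uses: the whole space with `m =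
0` (global Lipschitz bound), the sign boxes, and small balls around an equilibrium. -/
theorem norm_field_add_sub_le (μ : Fin p) {m : Fin N → ℝ} {s : Fin N → Set ℝ} {κ : ℝ}
    (hs : ∀ j, Convex ℝ (s j)) (hm : ∀ j, ∀ x ∈ s j, m j ≤ Real.tanh (W.gain * x) ^ 2)
    (hκ0 : 0 ≤ κ) (hκ : ∀ i, W.C₀ * W.β * ∑ j, |W.J₀ i j| * (1 - m j) ≤ κ)
    {u w : Fin N → ℝ} (hu : ∀ j, u j ∈ s j) (hw : ∀ j, w j ∈ s j) :
    ‖(W.field μ u + u) - (W.field μ w + w)‖ ≤ κ * ‖u - w‖ := by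
  refine (pi_norm_le_iff_of_nonneg (by positivity)).2 fun i => ?_
  have hCβ : 0 ≤ W.C₀ * W.βK := mul_nonneg W.C₀_pos.le W.βK_pos.le
  have h1 : ((W.field μ u + u) - (W.field μ w + w)) i = W.C₀ * W.βK *
      ∑ j, W.J₀ i j * (Real.tanh (W.gain * u j) - Real.tanh (W.gain * w j)) := by
    simp only [Pi.sub_apply, Pi.add_apply, field, mul_sub, Finset.sum_sub_distrib]
    ring
  rw [h1, Real.norm_eq_abs, abs_mul, abs_of_nonneg hCβ]
  calc W.C₀ * W.βK *
        |∑ j, W.J₀ i j * (Real.tanh (W.gain * u j) - Real.tanh (W.gain * w j))|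
      ≤ W.C₀ * W.βK * ∑ j, |W.J₀ i j| * (W.gain * (1 - m j) * ‖u - w‖) := by
        gcongr
        refine (Finset.abs_sum_le_sum_abs _ _).trans (Finset.sum_le_sum fun j _ => ?_)
        rw [abs_mul]
        gcongr
        have h2 := Real.abs_tanh_sub_le_of_convex W.gain_pos.le (hs j) (hm j) (hu j) (hw j)
        have h3 : 0 ≤ 1 - m j := by
          linarith [hm j _ (hu j), Real.one_sub_tanh_sq_pos (W.gain * u j)]
        exact h2.trans (mul_le_mul_of_nonneg_left (norm_le_pi_norm (u - w) j)
          (mul_nonneg W.gain_pos.le h3))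
    _ = (W.C₀ * W.β * ∑ j, |W.J₀ i j| * (1 - m j)) * ‖u - w‖ := by
        simp only [β, Finset.mul_sum, Finset.sum_mul]
        refine Finset.sum_congr rfl fun j _ => ?_
        ring
    _ ≤ κ * ‖u - w‖ := by
        gcongr
        exact hκ i

theorem contDiff_field (μ : Fin p) : ContDiff ℝ 1 (W.field μ) := by
  have hT : ∀ i, ContDiff ℝ 1 fun u : Fin N → ℝ => Real.tanh (W.gain * u i) := fun i =>
    Real.contDiff_tanh.comp (by fun_prop)
  refine contDiff_pi.2 fun i => ?_
  unfold field
  fun_prop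

theorem exists_lipschitzWith_field (μ : Fin p) : ∃ K, LipschitzWith K (W.field μ) := by
  obtain ⟨κ, hκ0, hκ⟩ : ∃ κ, 0 ≤ κ ∧
      ∀ i, W.C₀ * W.β * ∑ j, |W.J₀ i j| * (1 - (0 : Fin N → ℝ) j) ≤ κ := by
    obtain ⟨κ, hκ⟩ := (Set.finite_range fun i =>
      W.C₀ * W.β * ∑ j, |W.J₀ i j| * (1 - (0 : Fin N → ℝ) j)).bddAbove
    exact ⟨max κ 0, le_max_right _ _, fun i => (hκ ⟨i, rfl⟩).trans (le_max_left _ _)⟩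
  refine ⟨⟨κ + 1, by positivity⟩, LipschitzWith.of_dist_le_mul fun u w => ?_⟩
  have h := W.norm_field_add_sub_le μ (s := fun _ => Set.univ) (m := 0)
    (fun _ => convex_univ) (fun _ _ _ => sq_nonneg _) hκ0 hκ
    (u := u) (w := w) (fun _ => trivial) (fun _ => trivial)
  rw [dist_eq_norm, dist_eq_norm]
  calc ‖W.field μ u - W.field μ w‖
      = ‖((W.field μ u + u) - (W.field μ w + w)) - (u - w)‖ := by congr 1; abel
    _ ≤ κ * ‖u - w‖ + ‖u - w‖ := (norm_sub_le _ _).trans (by gcongr)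
    _ = (κ + 1) * ‖u - w‖ := by ring

theorem exists_isIntegralCurve_field (μ : Fin p) (u : Fin N → ℝ) :
    ∃ γ : ℝ → Fin N → ℝ, γ 0 = u ∧ IsIntegralCurve γ (fun _ => W.field μ) := by
  obtain ⟨K, hK⟩ := W.exists_lipschitzWith_field μ
  exact exists_isIntegralCurve_of_lipschitzWith (W.contDiff_field μ) hK u

/-! ### Coordinatewise slopes -/

/-- The derivative `∂ᵢ fᵢ` of the derived system where `uᵢ = x`. -/
def diagSlope (i : Fin N) (x : ℝ) : ℝ :=
  -1 + W.C₀ * W.βK * W.J₀ i i * (W.gain * (1 - Real.tanh (W.gain * x) ^ 2))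

theorem field_update (μ : Fin p) (u : Fin N → ℝ) (i : Fin N) (y : ℝ) :
    W.field μ (Function.update u i y) i = -y + W.C₀ * W.βK * W.J₀ i i * Real.tanh (W.gain * y)
      + (W.C₀ * W.βK * ∑ j ∈ Finset.univ.erase i, W.J₀ i j * Real.tanh (W.gain * u j)
        + W.C₁ * W.βK * W.β₁ * W.cycle i (μ + 1)) := by
  have h : ∑ j ∈ Finset.univ.erase i,
      W.J₀ i j * Real.tanh (W.gain * Function.update u i y j)
      = ∑ j ∈ Finset.univ.erase i, W.J₀ i j * Real.tanh (W.gain * u j) :=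
    Finset.sum_congr rfl fun j hj => by
      rw [Function.update_of_ne (Finset.ne_of_mem_erase hj)]
  rw [field, ← Finset.add_sum_erase _ _ (Finset.mem_univ i), h, Function.update_self]
  ring

/-- The constant `k` is arbitrary, so one slope serves both `fᵢ` along its own axis and the lower
bounding function. -/
theorem hasDerivAt_diagSlope (i : Fin N) (k x : ℝ) :
    HasDerivAt (fun y => -y + W.C₀ * W.βK * W.J₀ i i * Real.tanh (W.gain * y) + k)
      (W.diagSlope i x) x :=
  ((hasDerivAt_id x).neg.add
    ((Real.hasDerivAt_tanh_const_mul W.gain x).const_mul _)).add_const k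

theorem hasDerivAt_field_update (μ : Fin p) (u : Fin N → ℝ) (i : Fin N) (x : ℝ) :
    HasDerivAt (fun y => W.field μ (Function.update u i y) i) (W.diagSlope i x) x := by
  simp only [field_update]
  exact W.hasDerivAt_diagSlope i _ x

variable {W}

theorem IsTurningPoint.diagSlope_eq_zero {μ : Fin p} {i : Fin N} {x : ℝ}
    (h : W.IsTurningPoint μ i x) : W.diagSlope i x = 0 :=
  (W.hasDerivAt_field_update μ (fun _ => x) i x).unique (h _ rfl)

theorem diagSlope_lt_diagSlope {i : Fin N} (hJ : 0 < W.J₀ i i) {x y : ℝ} (h : |x| < |y|) :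
    W.diagSlope i y < W.diagSlope i x := by
  have hpos : 0 < W.C₀ * W.βK * W.J₀ i i := mul_pos (mul_pos W.C₀_pos W.βK_pos) hJ
  have hg := W.gain_pos
  have := Real.tanh_sq_lt_tanh_sq (x := W.gain * x) (y := W.gain * y) (by
    rw [abs_mul, abs_mul, abs_of_pos hg]
    gcongr)
  unfold diagSlope
  gcongr

/-- The energy has no local minimum at an equilibrium where some diagonal slope is positive. -/
theorem not_isLocalMin_energy {μ : Fin p} {u : Fin N → ℝ} {i : Fin N}
    (h0 : W.field μ u i = 0) (hs : 0 < W.diagSlope i (u i)) :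
    ¬ IsLocalMin (W.energy μ) u := by
  intro hmin
  have hφ : ∀ y, HasDerivAt (fun y => W.energy μ (Function.update u i y))
      (-(W.gain * (1 - Real.tanh (W.gain * y) ^ 2) * W.field μ (Function.update u i y) i)) y := by
    intro y
    refine (W.hasDerivAt_energy_comp μ (hasDerivAt_update u i y)).congr_deriv ?_
    rw [Finset.sum_eq_single i (fun j _ hj => by simp [hj]) (by simp)]
    simp
  have hmin' : ∀ᶠ y in nhdsWithin (u i) (Set.Ioi (u i)),
      W.energy μ u ≤ W.energy μ (Function.update u i y) := by
    have hc : Filter.Tendsto (fun y => Function.update u i y) (nhds (u i)) (nhds u) := by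
      have := (continuous_const.update i continuous_id :
        Continuous fun y : ℝ => Function.update u i y).tendsto (u i)
      simpa using this
    exact nhdsWithin_le_nhds (hc.eventually hmin)
  -- Along the `i`-th axis `fᵢ` vanishes at `u i` with positive slope, so it is positive just to the
  -- right, and there the energy strictly decreases.
  have hpos : ∀ᶠ y in nhdsWithin (u i) (Set.Ioi (u i)),
      0 < W.field μ (Function.update u i y) i := by
    have h1 := (W.hasDerivAt_field_update μ u i (u i)).tendsto_slope.eventually
      (eventually_gt_nhds hs)
    have h2 := h1.filter_mono (nhdsWithin_mono (u i) fun y (hy : u i < y) => hy.ne')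
    filter_upwards [h2, self_mem_nhdsWithin] with y hy hyu
    rw [slope_def_field, Function.update_eq_self, h0, sub_zero] at hy
    exact (div_pos_iff_of_pos_right (sub_pos.2 hyu)).1 hy
  obtain ⟨b, hb, hb'⟩ := mem_nhdsGT_iff_exists_Ioc_subset.1 (hmin'.and hpos)
  have hanti : StrictAntiOn (fun y => W.energy μ (Function.update u i y)) (Set.Icc (u i) b) := by
    refine strictAntiOn_of_hasDerivWithinAt_neg (convex_Icc _ _)
      (fun y _ => (hφ y).continuousAt.continuousWithinAt)
      (fun y _ => (hφ y).hasDerivWithinAt) fun y hy => ?_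
    rw [interior_Icc] at hy
    exact neg_neg_of_pos (mul_pos (mul_pos W.gain_pos (Real.one_sub_tanh_sq_pos _))
      (hb' ⟨hy.1, hy.2.le⟩).2)
  have hlt := hanti ⟨le_rfl, le_of_lt hb⟩ ⟨le_of_lt hb, le_rfl⟩ hb
  have hle := (hb' ⟨hb, le_rfl⟩).1
  simp only [Function.update_eq_self] at hlt
  exact absurd hle (not_le.2 hlt)

theorem diagSlope_nonpos_of_asymptoticallyStable {μ : Fin p} {u : Fin N → ℝ}
    (hu : IsAsymptoticallyStableEquilibrium (W.field μ) u) (i : Fin N) :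
    W.diagSlope i (u i) ≤ 0 := by
  by_contra! hs
  exact not_isLocalMin_energy (congrFun hu.equilibrium i) hs
    (hu.isLocalMin (W.exists_isIntegralCurve_field μ) (W.continuous_energy μ).continuousAt
      fun γ hγ => W.energy_antitone μ hγ)

end CyclicNetwork

/-- The sign `1` or `-1` encoded by a Boolean. -/
def boolSign (b : Bool) : ℝ := cond b 1 (-1)

theorem abs_boolSign (b : Bool) : |boolSign b| = 1 := by cases b <;> simp [boolSign]

theorem boolSign_mul_decide (x : ℝ) : boolSign (decide (0 < x)) * x = |x| := by
  by_cases h : 0 < x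
  · simp [h, boolSign, abs_of_pos h]
  · simp [h, boolSign, abs_of_nonpos (not_lt.1 h)]

/-! ### Sign boxes and their equilibria -/

namespace CyclicNetwork

variable {N p : ℕ} [NeZero p] (W : CyclicNetwork N p)

/-- By this reflection the zeros of the upper function are the negatives of those of the lower one,
so a single threshold serves both signs. -/
theorem upper_neg (i : Fin N) (x : ℝ) : W.upper i (-x) = -W.lower i x := by
  simp only [upper, lower, kPlus, kMinus, mul_neg, Real.tanh_neg]
  ring

/-- The off-diagonal and forcing terms have absolute value at most `kPlus`, since `|tanh| ≤ 1` and
`|ξ| = 1`; oddness of `tanh` carries the sign through the diagonal terms. -/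
theorem lower_le_sign_mul_field (μ : Fin p) (u : Fin N → ℝ) (i : Fin N) (b : Bool) :
    W.lower i (boolSign b * u i) ≤ boolSign b * W.field μ u i := by
  have hCβ : 0 ≤ W.C₀ * W.βK := mul_nonneg W.C₀_pos.le W.βK_pos.le
  have hC : 0 ≤ W.C₁ * W.βK * W.β₁ := by
    have := W.C₁_pos; have := W.βK_pos; have := W.β₁_pos
    positivity
  have hf := W.field_update μ u i (u i)
  rw [Function.update_eq_self] at hf
  set k := W.C₀ * W.βK * ∑ j ∈ Finset.univ.erase i, W.J₀ i j * Real.tanh (W.gain * u j)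
    + W.C₁ * W.βK * W.β₁ * W.cycle i (μ + 1) with hk
  have hk1 : |boolSign b * k| ≤ W.kPlus i := by
    rw [abs_mul, abs_boolSign, one_mul]
    refine (abs_add_le _ _).trans (add_le_add ?_ ?_)
    · rw [abs_mul, abs_of_nonneg hCβ]
      gcongr
      refine (Finset.abs_sum_le_sum_abs _ _).trans (Finset.sum_le_sum fun j _ => ?_)
      rw [abs_mul]
      exact mul_le_of_le_one_right (abs_nonneg _) (Real.abs_tanh_lt_one _).le
    · rw [abs_mul, W.abs_cycle, mul_one, abs_of_nonneg hC]
  have hk2 : W.kMinus i = -W.kPlus i := by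
    simp only [kPlus, kMinus]
    ring
  have hk3 := (abs_le.1 hk1).1
  have ht : Real.tanh (W.gain * (boolSign b * u i))
      = boolSign b * Real.tanh (W.gain * u i) := by
    cases b <;> simp [boolSign, Real.tanh_neg]
  rw [lower, hk2, ht, hf]
  linarith

variable {W}

theorem lower_strictAntiOn {i : Fin N} (hJ : 0 < W.J₀ i i) {q : ℝ} (hq : 0 < q)
    (hs : W.diagSlope i q = 0) : StrictAntiOn (W.lower i) (Set.Ici q) := by
  have hd := W.hasDerivAt_diagSlope i (W.kMinus i)
  refine strictAntiOn_of_hasDerivWithinAt_neg (convex_Ici q)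
    (fun y _ => (hd y).continuousAt.continuousWithinAt)
    (fun y _ => (hd y).hasDerivWithinAt) fun y hy => ?_
  rw [interior_Ici] at hy
  rw [← hs]
  refine diagSlope_lt_diagSlope hJ ?_
  rwa [abs_of_pos hq, abs_of_pos (hq.trans hy)]

/-- The greatest zero of the lower function lies beyond the positive turning point. -/
theorem lt_of_isGreatest_zero_lower {i : Fin N} (hJ : 0 < W.J₀ i i) {q c : ℝ}
    (hq : 0 < W.lower i q) (hc : IsGreatest {x | W.lower i x = 0} c) : q < c := by
  have ha : 0 < W.C₀ * W.βK * W.J₀ i i := mul_pos (mul_pos W.C₀_pos W.βK_pos) hJ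
  have hcont : Continuous (W.lower i) :=
    (Differentiable.continuous fun y => (W.hasDerivAt_diagSlope i (W.kMinus i) y).differentiableAt)
  -- Chosen so that `-b` outweighs the bounded terms: the lower function at `b` is at most `-|q|`.
  -- It therefore has a zero between `q` and `b`.
  set b := |q| + W.C₀ * W.βK * W.J₀ i i + |W.kMinus i| with hb
  have hqb : q ≤ b := by
    linarith [le_abs_self q, abs_nonneg (W.kMinus i)]
  have hneg : W.lower i b ≤ 0 := by
    have h1 : W.C₀ * W.βK * W.J₀ i i * Real.tanh (W.gain * b) ≤ W.C₀ * W.βK * W.J₀ i i :=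
      mul_le_of_le_one_right ha.le (Real.tanh_lt_one _).le
    rw [lower]
    linarith [abs_nonneg q, le_abs_self (W.kMinus i)]
  obtain ⟨z, hz, hz0⟩ := intermediate_value_Icc' hqb hcont.continuousOn ⟨hneg, hq.le⟩
  have hqz : q ≠ z := by
    rintro rfl
    exact hq.ne' hz0
  exact (lt_of_le_of_ne hz.1 hqz).trans_le (hc.2 hz0)

/-- The orthant-like box of states whose `i`-th coordinate has the sign `s i` and absolute value
at least `c i`. -/
def signBox (c : Fin N → ℝ) (s : Fin N → Bool) : Set (Fin N → ℝ) :=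
  {u | ∀ i, c i ≤ boolSign (s i) * u i}

theorem isClosed_signBox (c : Fin N → ℝ) (s : Fin N → Bool) : IsClosed (signBox c s) := by
  simp only [signBox, Set.ofPred_forall]
  exact isClosed_iInter fun i => isClosed_le continuous_const (by fun_prop)

theorem sq_tanh_le_of_mem_signBox {c : Fin N → ℝ} (hc : ∀ i, 0 < c i) {b : Bool} {j : Fin N}
    {x : ℝ} (hx : c j ≤ boolSign b * x) :
    Real.tanh (W.gain * c j) ^ 2 ≤ Real.tanh (W.gain * x) ^ 2 := by
  refine Real.tanh_sq_le_tanh_sq ?_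
  rw [abs_mul, abs_mul, abs_of_pos (hc j)]
  refine mul_le_mul_of_nonneg_left (hx.trans ((le_abs_self _).trans_eq ?_)) (abs_nonneg _)
  rw [abs_mul, abs_boolSign, one_mul]

/-- The map `x ↦ lower x + x` is increasing because `J⁰ᵢᵢ > 0`, and it fixes `c i`; so it keeps `[c
i, ∞)` invariant, and it bounds the signed coordinate of the image from below. -/
theorem mapsTo_signBox (μ : Fin p) {c : Fin N → ℝ} (hJ : ∀ i, 0 < W.J₀ i i)
    (hc0 : ∀ i, W.lower i (c i) = 0) (s : Fin N → Bool) :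
    Set.MapsTo (fun u => W.field μ u + u) (signBox c s) (signBox c s) := by
  intro u hu i
  have ha : 0 < W.C₀ * W.βK * W.J₀ i i := mul_pos (mul_pos W.C₀_pos W.βK_pos) (hJ i)
  have h1 := W.lower_le_sign_mul_field μ u i (s i)
  have h2 : Real.tanh (W.gain * c i) ≤ Real.tanh (W.gain * (boolSign (s i) * u i)) :=
    Real.strictMono_tanh_of_deriv.monotone (mul_le_mul_of_nonneg_left (hu i) W.gain_pos.le)
  have h3 := mul_le_mul_of_nonneg_left h2 ha.le
  have h4 := hc0 i
  rw [lower] at h1 h4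
  change c i ≤ boolSign (s i) * (W.field μ u i + u i)
  rw [mul_add]
  linarith

theorem exists_contraction_signBox {μ : Fin p} {c : Fin N → ℝ} (hcpos : ∀ i, 0 < c i)
    (hrow : ∀ i, W.C₀ * W.β * ∑ j, |W.J₀ i j| * (1 - Real.tanh (W.gain * c j) ^ 2) < 1)
    (s : Fin N → Bool) :
    ∃ κ, 0 ≤ κ ∧ κ < 1 ∧ ∀ u ∈ signBox c s, ∀ w ∈ signBox c s,
      ‖(W.field μ u + u) - (W.field μ w + w)‖ ≤ κ * ‖u - w‖ := by
  obtain ⟨κ, hκ0, hκ1, hκ⟩ := exists_lt_one_forall_le hrow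
  refine ⟨κ, hκ0, hκ1, fun u hu w hw => ?_⟩
  exact W.norm_field_add_sub_le μ (s := fun j => {x | c j ≤ boolSign (s j) * x})
    (fun j => convex_halfSpace_ge (IsLinearMap.isLinearMap_smul (boolSign (s j))) _)
    (fun j x hx => sq_tanh_le_of_mem_signBox hcpos hx) hκ0 hκ hu hw

theorem eq_of_mem_signBox {μ : Fin p} {c : Fin N → ℝ} (hcpos : ∀ i, 0 < c i)
    (hrow : ∀ i, W.C₀ * W.β * ∑ j, |W.J₀ i j| * (1 - Real.tanh (W.gain * c j) ^ 2) < 1)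
    {s : Fin N → Bool} {u w : Fin N → ℝ} (hu : u ∈ signBox c s)
    (hw : w ∈ signBox c s) (hu0 : W.field μ u = 0) (hw0 : W.field μ w = 0) : u = w := by
  obtain ⟨κ, hκ0, hκ1, hκ⟩ := exists_contraction_signBox (μ := μ) hcpos hrow s
  have h := hκ u hu w hw
  rw [hu0, hw0, zero_add, zero_add] at h
  have hn := norm_nonneg (u - w)
  exact sub_eq_zero.1 (norm_eq_zero.1 (by nlinarith))

theorem exists_equilibrium_mem_signBox {μ : Fin p} {c : Fin N → ℝ} (hcpos : ∀ i, 0 < c i)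
    (hrow : ∀ i, W.C₀ * W.β * ∑ j, |W.J₀ i j| * (1 - Real.tanh (W.gain * c j) ^ 2) < 1)
    (hJ : ∀ i, 0 < W.J₀ i i)
    (hc0 : ∀ i, W.lower i (c i) = 0) (s : Fin N → Bool) :
    ∃ u ∈ signBox c s, W.field μ u = 0 := by
  obtain ⟨κ, hκ0, hκ1, hκ⟩ := exists_contraction_signBox (μ := μ) hcpos hrow s
  have hmaps := mapsTo_signBox μ hJ hc0 s
  have hcontr : ContractingWith ⟨κ, hκ0⟩ (hmaps.restrict _ _ _) := by
    refine ⟨hκ1, LipschitzWith.of_dist_le_mul fun u w => ?_⟩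
    have := hκ u u.2 w w.2
    rwa [← dist_eq_norm, ← dist_eq_norm] at this
  -- The corner of the box is the starting point of the iteration.
  have hmem : (fun i => boolSign (s i) * c i) ∈ signBox c s := fun i => by
    rw [← mul_assoc, ← abs_mul_abs_self, abs_boolSign, one_mul, one_mul]
  obtain ⟨u, hu, hfix, -⟩ := hcontr.exists_fixedPoint' (isClosed_signBox c s).isComplete hmaps
    hmem (edist_ne_top _ _)
  exact ⟨u, hu, add_eq_right.1 hfix⟩

/-- The equilibrium may lie on the boundary of its box, so the contraction on the box need not cover
a neighbourhood. The row inequalities are strict, however, and survive lowering each `tanh²` by a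
small `ε`, which gives a contraction on a whole ball. -/
theorem isAsymptoticallyStable_of_mem_signBox {μ : Fin p} {c : Fin N → ℝ} (hcpos : ∀ i, 0 < c i)
    (hrow : ∀ i, W.C₀ * W.β * ∑ j, |W.J₀ i j| * (1 - Real.tanh (W.gain * c j) ^ 2) < 1)
    {s : Fin N → Bool} {u : Fin N → ℝ}
    (hu : u ∈ signBox c s) (hu0 : W.field μ u = 0) :
    IsAsymptoticallyStableEquilibrium (W.field μ) u := by
  have hrow' : ∀ i, W.C₀ * W.β * ∑ j, |W.J₀ i j| * (1 - Real.tanh (W.gain * u j) ^ 2) < 1 := by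
    have hCβ : 0 ≤ W.C₀ * W.β := mul_nonneg W.C₀_pos.le W.β_pos.le
    refine fun i => lt_of_le_of_lt ?_ (hrow i)
    exact mul_le_mul_of_nonneg_left (Finset.sum_le_sum fun j _ => mul_le_mul_of_nonneg_left
      (sub_le_sub_left (sq_tanh_le_of_mem_signBox hcpos (hu j)) _) (abs_nonneg _)) hCβ
  obtain ⟨ε, hε, hεrow⟩ : ∃ ε > 0, ∀ i,
      W.C₀ * W.β * ∑ j, |W.J₀ i j| * (1 - (Real.tanh (W.gain * u j) ^ 2 - ε)) < 1 := by
    have h : ∀ᶠ ε in nhdsWithin (0 : ℝ) (Set.Ioi 0), ∀ i,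
        W.C₀ * W.β * ∑ j, |W.J₀ i j| * (1 - (Real.tanh (W.gain * u j) ^ 2 - ε)) < 1 := by
      refine nhdsWithin_le_nhds (Filter.eventually_all.2 fun i => ?_)
      have hc : Continuous fun ε : ℝ =>
          W.C₀ * W.β * ∑ j, |W.J₀ i j| * (1 - (Real.tanh (W.gain * u j) ^ 2 - ε)) := by
        fun_prop
      exact hc.continuousAt.eventually_lt continuousAt_const (by simpa using hrow' i)
    obtain ⟨ε, h1, h2⟩ := (h.and self_mem_nhdsWithin).exists
    exact ⟨ε, h2, h1⟩
  obtain ⟨κ, hκ0, hκ1, hκ⟩ := exists_lt_one_forall_le hεrow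
  have hcont : Continuous fun x => Real.tanh (W.gain * x) ^ 2 :=
    ((Real.contDiff_tanh (n := 0)).continuous.comp (by fun_prop)).pow 2
  obtain ⟨r, hr, hball⟩ : ∃ r > 0, ∀ j, ∀ x ∈ Metric.closedBall (u j) r,
      Real.tanh (W.gain * u j) ^ 2 - ε ≤ Real.tanh (W.gain * x) ^ 2 := by
    have h : ∀ j, ∀ᶠ r in nhdsWithin (0 : ℝ) (Set.Ioi 0), ∀ x ∈ Metric.closedBall (u j) r,
        Real.tanh (W.gain * u j) ^ 2 - ε ≤ Real.tanh (W.gain * x) ^ 2 := fun j => by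
      have hev : ∀ᶠ x in nhds (u j),
          Real.tanh (W.gain * u j) ^ 2 - ε ≤ Real.tanh (W.gain * x) ^ 2 :=
        hcont.continuousAt.eventually (eventually_ge_nhds (sub_lt_self _ hε))
      obtain ⟨r₀, hr₀, hb⟩ := Metric.nhds_basis_closedBall.eventually_iff.1 hev
      filter_upwards [nhdsWithin_le_nhds (eventually_le_nhds hr₀)] with r hr x hx
      exact hb (Metric.closedBall_subset_closedBall hr hx)
    obtain ⟨r, h1, h2⟩ := ((Filter.eventually_all.2 h).and self_mem_nhdsWithin).exists
    exact ⟨r, h2, h1⟩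
  refine isAsymptoticallyStableEquilibrium_of_contracting hu0 hκ1 hr fun x hx => ?_
  have h := W.norm_field_add_sub_le μ (s := fun j => Metric.closedBall (u j) r)
    (fun j => convex_closedBall _ _) hball hκ0 hκ (u := x) (w := u)
    (fun j => by
      rw [Metric.mem_closedBall, dist_eq_norm]
      exact (norm_le_pi_norm (x - u) j).trans hx)
    (fun j => Metric.mem_closedBall_self hr.le)
  rwa [hu0, zero_add, add_sub_assoc] at h

/-- An asymptotically stable equilibrium lies in the box of its own signs. -/
theorem mem_signBox_of_asymptoticallyStable {μ : Fin p} {q c : Fin N → ℝ}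
    (hJ : ∀ i, 0 < W.J₀ i i) (hq : ∀ i, 0 < q i) (hs : ∀ i, W.diagSlope i (q i) = 0)
    (hqc : ∀ i, q i ≤ c i) (hc0 : ∀ i, W.lower i (c i) = 0) {u : Fin N → ℝ}
    (hu : IsAsymptoticallyStableEquilibrium (W.field μ) u) :
    u ∈ signBox c fun i => decide (0 < u i) := by
  intro i
  rw [boolSign_mul_decide]
  -- Strictly between the turning points the diagonal slope is positive, which stability forbids.
  have h1 : q i ≤ |u i| := by
    by_contra! h
    rw [← abs_of_pos (hq i)] at h
    have := diagSlope_lt_diagSlope (hJ i) h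
    rw [hs i] at this
    exact this.not_ge (diagSlope_nonpos_of_asymptoticallyStable hu i)
  -- With the sign of `u i` itself, the lower function at `|u i|` is at most `0`, its value at `c
  -- i`; strict decrease beyond `q i` then compares the arguments.
  have h2 := W.lower_le_sign_mul_field μ u i (decide (0 < u i))
  rw [hu.equilibrium, boolSign_mul_decide, Pi.zero_apply, mul_zero, ← hc0 i] at h2
  exact ((lower_strictAntiOn (hJ i) (hq i) (hs i)).le_iff_ge h1 (hqc i)).1 h2

theorem ncard_asymptoticallyStable {μ : Fin p} {q c : Fin N → ℝ}
    (hJ : ∀ i, 0 < W.J₀ i i) (hq : ∀ i, 0 < q i) (hs : ∀ i, W.diagSlope i (q i) = 0)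
    (hqc : ∀ i, q i ≤ c i) (hc0 : ∀ i, W.lower i (c i) = 0)
    (hrow : ∀ i, W.C₀ * W.β * ∑ j, |W.J₀ i j| * (1 - Real.tanh (W.gain * c j) ^ 2) < 1) :
    {u : Fin N → ℝ | IsAsymptoticallyStableEquilibrium (W.field μ) u}.ncard = 2 ^ N := by
  have hcpos : ∀ i, 0 < c i := fun i => (hq i).trans_le (hqc i)
  choose e he he0 using exists_equilibrium_mem_signBox (μ := μ) hcpos hrow hJ hc0
  have hinj : Function.Injective e := by
    intro s t hst
    ext i
    have h1 := (hcpos i).trans_le (he s i)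
    have h2 := (hcpos i).trans_le (he t i)
    rw [← hst] at h2
    -- For different signs the common point would have an `i`-th coordinate both positive and
    -- negative.
    cases hsi : s i <;> cases hti : t i <;> simp only [hsi, hti, boolSign, cond] at h1 h2 ⊢ <;>
      linarith
  have hset : {u : Fin N → ℝ | IsAsymptoticallyStableEquilibrium (W.field μ) u}
      = Set.range e := by
    ext u
    constructor
    · intro hu
      have hmem := mem_signBox_of_asymptoticallyStable hJ hq hs hqc hc0 hu
      exact ⟨_, eq_of_mem_signBox hcpos hrow (he _) hmem (he0 _) hu.equilibrium⟩
    · rintro ⟨s, rfl⟩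
      exact isAsymptoticallyStable_of_mem_signBox hcpos hrow (he s) (he0 s)
  rw [hset, ← Set.image_univ, Set.ncard_image_of_injective _ hinj, Set.ncard_univ]
  simp

end CyclicNetwork

end

theorem mainTheorem8 {N p : ℕ} [NeZero p] (W : CyclicNetwork N p) (μ : Fin p)
    -- the first condition
    (H1 : ∀ i, 1 < W.C₀ * W.β * W.J₀ i i)
    -- the turning points, one on each side of the origin, and the second condition
    (pt qt : Fin N → ℝ)
    (hpt : ∀ i, pt i < 0 ∧ W.IsTurningPoint μ i (pt i))
    (hqt : ∀ i, 0 < qt i ∧ W.IsTurningPoint μ i (qt i))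
    (H2 : ∀ i, 0 < W.lower i (qt i) ∧ W.upper i (pt i) < 0)
    -- the least zero of the upper and the greatest zero of the lower function
    (aHat cCheck : Fin N → ℝ)
    (haHat : ∀ i, IsLeast {x | W.upper i x = 0} (aHat i))
    (hcCheck : ∀ i, IsGreatest {x | W.lower i x = 0} (cCheck i))
    -- the points where the slope of the activation function is compared, and the third condition
    (η : Fin N → ℝ)
    (hη : ∀ j, Real.tanh (W.gain * η j) ^ 2 =
      min (Real.tanh (W.gain * cCheck j) ^ 2) (Real.tanh (W.gain * aHat j) ^ 2))
    (H3 : ∀ i, W.C₀ * W.β * ∑ j, |W.J₀ i j| * (1 - Real.tanh (W.gain * η j) ^ 2) < 1) :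
    {u : Fin N → ℝ | IsAsymptoticallyStableEquilibrium (W.field μ) u}.ncard = 2 ^ N := by
  have hJ : ∀ i, 0 < W.J₀ i i := fun i =>
    pos_of_mul_pos_right (one_pos.trans (H1 i)) (mul_pos W.C₀_pos W.β_pos).le
  have hqc : ∀ i, qt i < cCheck i := fun i =>
    CyclicNetwork.lt_of_isGreatest_zero_lower (hJ i) (H2 i).1 (hcCheck i)
  -- By reflection the two arguments of the minimum in `hη` coincide, and (H3) becomes the row bound
  -- at `cCheck`.
  have hac : ∀ i, aHat i = -cCheck i := fun i => by
    refine (haHat i).unique ⟨?_, fun x hx => ?_⟩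
    · simpa [W.upper_neg] using (hcCheck i).1
    · have hx' : W.lower i (-x) = 0 := by
        have := W.upper_neg i (-x)
        rw [neg_neg, show W.upper i x = 0 from hx] at this
        linarith
      linarith [(hcCheck i).2 hx']
  refine CyclicNetwork.ncard_asymptoticallyStable hJ (fun i => (hqt i).1)
    (fun i => (hqt i).2.diagSlope_eq_zero) (fun i => (hqc i).le) (fun i => (hcCheck i).1)
    fun i => ?_
  simpa [hη, hac, Real.tanh_neg] using H3 i
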